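/- Let $G$ be a countable group, $I$ and $J$ finite index sets, and $P=(P_{j,i})$ a $J\times I$ matrix with entries in $G$. Let $S=\mathcal M(G;I,J;P)$ be the Rees matrix semigroup: its elements are the symbols $s\epsilon_{i,j}$ ($s\in G$, $i\in I$, $j\in J$), with product $s\epsilon_{i,j}\cdot t\epsilon_{k,l}=sP_{j,k}t\,\epsilon_{i,l}$. Regard $\ell^1(S)$ as a Banach algebra over $\mathbb C$ under convolution ($\delta_s*\delta_t=\delta_{st}$), with dual $\ell^\infty(S)$. A *predual* of $\ell^1(S)$ is a norm-closed subspace $E\subseteq\ell^\infty(S)$ which is a sub-bimodule for the dual actions of $\ell^1(S)$, given by $\langle b,f\cdot a\rangle=\langle a*b,f\rangle$ and $\langle b,a\cdot f\rangle=\langle b*a,f\rangle$, and for which the canonical map $\ell^1(S)\to E^*$ is a (not necessarily isometric) isomorphism of Banach spaces. It is a *Hopf algebra predual* if moreover $E$ is a subalgebra of $\ell^\infty(S)$ under pointwise multiplication, and a *C$^*$-predual* if $E$ is a C$^*$-subalgebra of $\ell^\infty(S)$. Then: 1. $c_0(S)$ is a C$^*$-predual of $\ell^1(S)$, and it is the only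 C$^*$-predual of $\ell^1(S)$; 2. $c_0(S)$ is also the only Hopf algebra predual of $\ell^1(S)$; 3. every locally compact Hausdorff topology on $S$ for which the product of $S$ is separately continuous is discrete. -/

import Mathlib

open scoped ENNReal Topology

noncomputable section

/-- The Rees matrix semigroup `M(T; I, J; P)` with sandwich matrix `P`, a `J × I` matrix with
entries in `T`.  The element `⟨i, s, j⟩` is `s ε_{i,j}`, the `I × J` matrix whose only entry is
`s`, in position `(i, j)`. -/
@[ext]
structure ReesMatrix {T I J : Type*} (P : Matrix J I T) where
  row : I
  val : T
  col : J

namespace ReesMatrix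

/-- `s ε_{i,j} · t ε_{k,l} = (s P_{j,k} t) ε_{i,l}`. -/
instance {T I J : Type*} [Semigroup T] (P : Matrix J I T) : Semigroup (ReesMatrix P) where
  mul x y := ⟨x.row, x.val * P x.col y.row * y.val, y.col⟩
  mul_assoc x y z := by
    change ReesMatrix.mk x.row (x.val * P x.col y.row * y.val * P y.col z.row * z.val) z.col =
      ReesMatrix.mk x.row (x.val * P x.col y.row * (y.val * P y.col z.row * z.val)) z.col
    simp only [mul_assoc]

theorem mk_mul_mk {T I J : Type*} [Semigroup T] (P : Matrix J I T) (i k : I) (j l : J)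
    (s t : T) : (⟨i, s, j⟩ * ⟨k, t, l⟩ : ReesMatrix P) = ⟨i, s * P j k * t, l⟩ := rfl

end ReesMatrix

namespace SemigroupAlgebra

/-- The Banach space `ℓ¹(S)` of absolutely summable complex functions on `S`. -/
abbrev Ell1 (S : Type*) := lp (fun _ : S => ℂ) 1

/-- The C⋆-algebra `ℓ^∞(S)` of bounded complex functions on `S`, with pointwise operations. -/
abbrev EllInf (S : Type*) := lp (fun _ : S => ℂ) ∞

/-- The duality pairing `⟨a, f⟩ = ∑ₛ a(s) f(s)` identifying `ℓ^∞(S)` with the dual of `ℓ¹(S)`. -/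
def pairing {S : Type*} (a : Ell1 S) (f : EllInf S) : ℂ := ∑' s, a s * f s

theorem summable_norm_apply {S : Type*} (a : Ell1 S) : Summable fun s => ‖a s‖ := by
  simpa using (lp.memℓp a).summable (by simp)

/-- The series defining `pairing` converges absolutely. -/
theorem summable_pairing {S : Type*} (a : Ell1 S) (f : EllInf S) :
    Summable fun s => a s * f s := by
  refine Summable.of_norm_bounded ((summable_norm_apply a).mul_right ‖f‖) fun s => ?_
  rw [norm_mul]
  exact mul_le_mul_of_nonneg_left (lp.norm_apply_le_norm (by simp) f s) (norm_nonneg _)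

open scoped Classical in
/-- The convolution product of `ℓ¹(S)`, i.e. `δ_s * δ_t = δ_{st}` extended bilinearly and
continuously: `a * b = ∑_{s,t} a(s) b(t) δ_{st}`, a norm convergent sum in `ℓ¹(S)`. -/
def conv {S : Type*} [Mul S] (a b : Ell1 S) : Ell1 S :=
  ∑' p : S × S, lp.single 1 (p.1 * p.2) (a p.1 * b p.2)

open scoped Classical in
/-- The series defining `conv` converges in norm. -/
theorem summable_conv {S : Type*} [Mul S] (a b : Ell1 S) :
    Summable fun p : S × S =>
      (lp.single 1 (p.1 * p.2) (a p.1 * b p.2) : Ell1 S) := by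
  refine Summable.of_norm ?_
  have h := (summable_norm_apply a).mul_of_nonneg (summable_norm_apply b)
    (fun _ => norm_nonneg _) (fun _ => norm_nonneg _)
  refine h.congr fun p => ?_
  rw [lp.norm_single (by simp), norm_mul]

/-- A predual of the Banach algebra `ℓ¹(S)`: a closed subspace `E` of `ℓ^∞(S) = ℓ¹(S)*` which is
a submodule for the two actions `⟨b, f·a⟩ = ⟨a * b, f⟩` and `⟨b, a·f⟩ = ⟨b * a, f⟩` of `ℓ¹(S)`,
and such that the canonical map `ℓ¹(S) → E*` is an isomorphism of Banach spaces (not necessarily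
isometric). -/
structure IsPredual {S : Type*} [Mul S] (E : Submodule ℂ (EllInf S)) : Prop where
  isClosed : IsClosed (E : Set (EllInf S))
  right_action : ∀ f ∈ E, ∀ a : Ell1 S, ∃ g ∈ E, ∀ b, pairing b g = pairing (conv a b) f
  left_action : ∀ f ∈ E, ∀ a : Ell1 S, ∃ g ∈ E, ∀ b, pairing b g = pairing (conv b a) f
  dual_equiv : ∃ e : Ell1 S ≃L[ℂ] StrongDual ℂ E, ∀ a (f : E), e a f = pairing a f

/-- A Hopf algebra predual of `ℓ¹(S)`: a predual which is a subalgebra of `ℓ^∞(S)`. -/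
structure IsHopfAlgebraPredual {S : Type*} [Mul S] (E : Submodule ℂ (EllInf S)) : Prop
    extends IsPredual E where
  mul_mem : ∀ f ∈ E, ∀ g ∈ E, f * g ∈ E

/-- A C⋆-predual of `ℓ¹(S)`: a predual which is a C⋆-subalgebra of `ℓ^∞(S)`. -/
structure IsCStarPredual {S : Type*} [Mul S] (E : Submodule ℂ (EllInf S)) : Prop
    extends IsHopfAlgebraPredual E where
  star_mem : ∀ f ∈ E, star f ∈ E

/-- `c₀(S)`: the bounded functions on the discrete set `S` that vanish at infinity. -/
def c0 (S : Type*) : Submodule ℂ (EllInf S) where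
  carrier := {f | Filter.Tendsto (fun s => f s) Filter.cofinite (𝓝 0)}
  zero_mem' := tendsto_const_nhds
  add_mem' {f g} hf hg := by
    have h := Filter.Tendsto.add (Set.mem_ofPred.mp hf) (Set.mem_ofPred.mp hg)
    simpa using h
  smul_mem' c f hf := by
    have h := Filter.Tendsto.const_smul (Set.mem_ofPred.mp hf) c
    simpa using h

end SemigroupAlgebra

end

/-! Since entries of `P` are invertible, `x ↦ a * x * b` has finite fibres: the row and column of
`x` take finitely many values, and given them its group entry is determined. Hence one-sided
translations are finite-to-one as well and preserve `c₀(S)`, whose dual is `ℓ¹(S)`; this makes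
`c₀(S)` a C⋆-predual (`isCStarPredual_c0`).

Uniqueness rests on the topology that a predual puts on `S`. For a Hopf algebra predual `E`, the
multiplicative functionals form a weak-star compact set consisting of the evaluations at points of
`S` and possibly zero. Thus `S` inherits a locally compact Hausdorff topology, with separately
continuous product because `E` is translation invariant. Baire category and the finite fibres force
this topology to be discrete (`ReesMatrix.discreteTopology`). Then `E` lies in `c₀(S)`, and
Hahn–Banach gives equality. -/

open Filter Topology

/-! ### Finite-to-one translations and discreteness -/

namespace ReesMatrix

variable {G I J : Type*} [Group G] [Finite I] [Finite J] (P : Matrix J I G)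

theorem finite_setOf_mul_mul_eq (a b c : ReesMatrix P) : {x | a * x * b = c}.Finite := by
  refine Set.Finite.of_finite_image (f := fun x => (x.row, x.col)) (Set.toFinite _) ?_
  rintro ⟨i, s, j⟩ hx ⟨k, t, l⟩ hy h
  obtain ⟨rfl, rfl⟩ : i = k ∧ j = l := by simpa using h
  have h2 := congrArg ReesMatrix.val ((show _ = c from hx).trans (show _ = c from hy).symm)
  change a.val * P a.col i * s * P j b.row * b.val = a.val * P a.col i * t * P j b.row * b.val at h2
  simpa using h2

theorem tendsto_const_mul_cofinite (a : ReesMatrix P) :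
    Tendsto (a * ·) cofinite cofinite := by
  refine Tendsto.cofinite_of_finite_preimage_singleton fun c => ?_
  -- Multiplying `a * x = c` by `a` on the right reduces to the two-sided case.
  refine (finite_setOf_mul_mul_eq P a a (c * a)).subset ?_
  rintro x rfl
  rfl

theorem tendsto_mul_const_cofinite (a : ReesMatrix P) :
    Tendsto (· * a) cofinite cofinite := by
  refine Tendsto.cofinite_of_finite_preimage_singleton fun c => ?_
  refine (finite_setOf_mul_mul_eq P a a (a * c)).subset ?_
  rintro x rfl
  exact mul_assoc a x a

instance [Countable G] : Countable (ReesMatrix P) :=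
  Function.Injective.countable (f := fun x : ReesMatrix P => (x.row, x.val, x.col))
    fun x y h => by
      simp only [Prod.mk.injEq] at h
      exact ReesMatrix.ext h.1 h.2.1 h.2.2

/-- By the Baire category theorem some point is isolated, and the two-sided translations
`x ↦ a * x * b`, which act transitively with finite fibres, make every point isolated. -/
theorem discreteTopology [Countable G] [TopologicalSpace (ReesMatrix P)]
    [T2Space (ReesMatrix P)] [LocallyCompactSpace (ReesMatrix P)]
    [SeparatelyContinuousMul (ReesMatrix P)] : DiscreteTopology (ReesMatrix P) := by
  rw [discreteTopology_iff_isOpen_singleton]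
  intro x
  have : Nonempty (ReesMatrix P) := ⟨x⟩
  obtain ⟨y, hy⟩ : ∃ y : ReesMatrix P, IsOpen {y} := by
    obtain ⟨y, z, hz⟩ := nonempty_interior_of_iUnion_of_closed
      (f := fun y : ReesMatrix P => {y}) (fun y => isClosed_singleton) (by ext; simp)
    obtain rfl : z = y := Set.mem_singleton_iff.mp (interior_subset hz)
    refine ⟨z, ?_⟩
    rw [← Set.Nonempty.subset_singleton_iff ⟨z, hz⟩ |>.mp interior_subset]
    exact isOpen_interior
  -- The inner indices `a.col` and `b.row` are free; this choice makes both sandwich entries equal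
  -- to `P x.col x.row`, and the inverse cancels them together with `x.val`.
  let a : ReesMatrix P := ⟨y.row, y.val * (P x.col x.row * x.val * P x.col x.row)⁻¹, x.col⟩
  let b : ReesMatrix P := ⟨x.row, 1, y.col⟩
  have hab : a * x * b = y := by
    refine ReesMatrix.ext rfl ?_ rfl
    change y.val * (P x.col x.row * x.val * P x.col x.row)⁻¹ * P x.col x.row * x.val *
      P x.col x.row * 1 = y.val
    group
  have hcont : Continuous fun z => a * z * b :=
    SeparatelyContinuousMul.continuous_mul_const.comp SeparatelyContinuousMul.continuous_const_mul
  -- This fibre is an open finite set containing `x`; deleting its other points, a closed set,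
  -- leaves `{x}`.
  have hopen : IsOpen {z | a * z * b = y} := hy.preimage hcont
  have hfin : ({z | a * z * b = y} \ {x}).Finite :=
    (finite_setOf_mul_mul_eq P a b y).subset Set.sdiff_subset
  convert hopen.sdiff hfin.isClosed using 1
  rw [Set.sdiff_sdiff_cancel_left (by simpa using hab)]

end ReesMatrix

/-! ### The duality between `ℓ¹(S)` and `ℓ^∞(S)` -/

namespace SemigroupAlgebra

variable {S : Type*}

theorem norm_apply_le (f : EllInf S) (s : S) : ‖f s‖ ≤ ‖f‖ :=
  lp.norm_apply_le_norm (by simp) f s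

theorem norm_ell1_eq_tsum (a : Ell1 S) : ‖a‖ = ∑' s, ‖a s‖ := by
  simpa using lp.norm_eq_tsum_rpow (p := 1) (by simp) a

theorem norm_pairing_le (a : Ell1 S) (f : EllInf S) : ‖pairing a f‖ ≤ ‖a‖ * ‖f‖ := by
  rw [norm_ell1_eq_tsum, ← tsum_mul_right]
  refine tsum_of_norm_bounded ((summable_norm_apply a).mul_right ‖f‖).hasSum fun s => ?_
  rw [norm_mul]
  exact mul_le_mul_of_nonneg_left (norm_apply_le f s) (norm_nonneg _)

/-- The duality pairing as a bounded bilinear map. -/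
noncomputable def pairingCLM (S : Type*) : Ell1 S →L[ℂ] EllInf S →L[ℂ] ℂ :=
  LinearMap.mkContinuous₂
    (LinearMap.mk₂ ℂ pairing
      (fun a b f => by
        simp only [pairing, lp.coeFn_add, Pi.add_apply, add_mul]
        exact (summable_pairing a f).tsum_add (summable_pairing b f))
      (fun c a f => by
        simp only [pairing, lp.coeFn_smul, Pi.smul_apply, smul_eq_mul, mul_assoc]
        exact tsum_mul_left)
      (fun a f g => by
        simp only [pairing, lp.coeFn_add, Pi.add_apply, mul_add]
        exact (summable_pairing a f).tsum_add (summable_pairing a g))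
      (fun c a f => by
        simp only [pairing, lp.coeFn_smul, Pi.smul_apply, smul_eq_mul, mul_left_comm]
        exact tsum_mul_left))
    1 (fun a f => by simpa using norm_pairing_le a f)

@[simp]
theorem pairingCLM_apply (a : Ell1 S) (f : EllInf S) : pairingCLM S a f = pairing a f := rfl

open scoped Classical in
@[simp]
theorem pairing_single (s : S) (c : ℂ) (f : EllInf S) :
    pairing (lp.single 1 s c) f = c * f s := by
  rw [pairing, tsum_eq_single s]
  · simp
  · intro t ht
    simp [Pi.single_eq_of_ne ht]

theorem pairing_conv [Mul S] (a b : Ell1 S) (f : EllInf S) :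
    pairing (conv a b) f = ∑' p : S × S, a p.1 * b p.2 * f (p.1 * p.2) := by
  classical
  change (pairingCLM S).flip f (conv a b) = _
  rw [conv, ContinuousLinearMap.map_tsum _ (summable_conv a b)]
  simp

theorem summable_conv_apply [Mul S] (a b : Ell1 S) (f : EllInf S) :
    Summable fun p : S × S => a p.1 * b p.2 * f (p.1 * p.2) := by
  have h := (summable_norm_apply a).mul_of_nonneg (summable_norm_apply b)
    (fun _ => norm_nonneg _) (fun _ => norm_nonneg _)
  refine Summable.of_norm_bounded (h.mul_right ‖f‖) fun p => ?_
  rw [norm_mul, norm_mul]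
  exact mul_le_mul_of_nonneg_left (norm_apply_le f _) (by positivity)

open scoped Classical in
@[simp]
theorem pairing_conv_single [Mul S] (s t : S) (f : EllInf S) :
    pairing (conv (lp.single 1 s 1) (lp.single 1 t 1)) f = f (s * t) := by
  rw [pairing_conv, tsum_eq_single (s, t)]
  · simp
  · rintro ⟨x, y⟩ h
    by_cases hx : x = s
    · have hy : y ≠ t := by rintro rfl; exact h (by rw [hx])
      simp [Pi.single_eq_of_ne hy]
    · simp [Pi.single_eq_of_ne hx]

/-! ### `c₀(S)` and its dual -/

theorem mem_c0 {f : EllInf S} : f ∈ c0 S ↔ Tendsto (fun s => f s) cofinite (𝓝 0) := Iff.rfl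

theorem isClosed_c0 : IsClosed (c0 S : Set (EllInf S)) := by
  refine isClosed_of_closure_subset fun f hf => ?_
  rw [SetLike.mem_coe, mem_c0, Metric.tendsto_nhds]
  intro ε hε
  obtain ⟨g, hg, hfg⟩ := Metric.mem_closure_iff.mp hf (ε / 2) (half_pos hε)
  filter_upwards [(Metric.tendsto_nhds.mp (mem_c0.mp hg)) (ε / 2) (half_pos hε)] with s hs
  rw [dist_zero_right] at hs ⊢
  rw [dist_eq_norm] at hfg
  have h := norm_apply_le (f - g) s
  rw [lp.coeFn_sub, Pi.sub_apply] at h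
  have h3 := norm_add_le (f s - g s) (g s)
  rw [sub_add_cancel] at h3
  linarith

theorem mul_mem_c0 {f g : EllInf S} (hf : f ∈ c0 S) (hg : g ∈ c0 S) : f * g ∈ c0 S := by
  rw [mem_c0] at *
  simpa using hf.mul hg

theorem star_mem_c0 {f : EllInf S} (hf : f ∈ c0 S) : star f ∈ c0 S := by
  rw [mem_c0] at *
  simpa using hf.star

open scoped Classical in
theorem single_mem_c0 (s : S) (c : ℂ) : (lp.single ∞ s c : EllInf S) ∈ c0 S := by
  rw [mem_c0]
  refine tendsto_const_nhds.congr' ?_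
  filter_upwards [(Set.finite_singleton s).compl_mem_cofinite] with t ht
  exact (lp.single_apply_ne (E := fun _ : S => ℂ) ∞ s c ht).symm

open scoped Classical in
/-- A function vanishing at infinity is the norm limit of its finite truncations. -/
theorem hasSum_single_of_mem_c0 {f : EllInf S} (hf : f ∈ c0 S) :
    HasSum (fun s => (lp.single ∞ s (f s) : EllInf S)) f := by
  rw [HasSum, Metric.tendsto_nhds]
  intro ε hε
  have hfin := (Metric.tendsto_nhds.mp (mem_c0.mp hf)) (ε / 2) (half_pos hε)
  rw [eventually_cofinite] at hfin
  filter_upwards [eventually_ge_atTop hfin.toFinset] with F hF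
  rw [dist_eq_norm]
  refine lt_of_le_of_lt (lp.norm_le_of_forall_le (half_pos hε).le fun s => ?_) (half_lt_self hε)
  rw [lp.coeFn_sub, Pi.sub_apply, lp.coeFn_sum, Finset.sum_apply]
  simp only [lp.single_apply, Finset.sum_pi_single]
  split_ifs with hs
  · simpa using (half_pos hε).le
  · have : s ∉ hfin.toFinset := fun h => hs (hF h)
    simp only [Set.Finite.mem_toFinset, Set.mem_ofPred_eq, not_not, dist_zero_right] at this
    simpa using this.le

open scoped Classical in
/-- The point masses, as elements of `c₀(S)`. -/
noncomputable def c0Single (s : S) : ℂ →ₗ[ℂ] c0 S :=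
  (lp.lsingle (𝕜 := ℂ) (E := fun _ : S => ℂ) ∞ s).codRestrict (c0 S) (single_mem_c0 s)

open scoped Classical in
@[simp]
theorem coe_c0Single (s : S) (c : ℂ) :
    (c0Single s c : EllInf S) = lp.single (E := fun _ : S => ℂ) ∞ s c := rfl

/-- Supplies the unit-ball test vectors that show the coefficients of a functional on `c₀(S)` to be
summable. -/
theorem norm_sum_c0Single_le (F : Finset S) {c : S → ℂ} (hc : ∀ s, ‖c s‖ ≤ 1) :
    ‖∑ s ∈ F, c0Single s (c s)‖ ≤ 1 := by
  classical
  change ‖((∑ s ∈ F, c0Single s (c s) : c0 S) : EllInf S)‖ ≤ 1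
  rw [AddSubmonoidClass.coe_finsetSum]
  refine lp.norm_le_of_forall_le zero_le_one fun s => ?_
  rw [lp.coeFn_sum, Finset.sum_apply]
  simp only [coe_c0Single, lp.single_apply, Finset.sum_pi_single]
  split_ifs
  · exact hc s
  · simp

/-- Every bounded functional on `c₀(S)` is given by an element of `ℓ¹(S)`. -/
theorem exists_pairing_eq (φ : StrongDual ℂ (c0 S)) :
    ∃ a : Ell1 S, ∀ f : c0 S, φ f = pairing a f := by
  classical
  let u (s : S) : ℂ := φ (c0Single s 1)
  have hu (s : S) (c : ℂ) : φ (c0Single s c) = u s * c := by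
    have h : c0Single s c = c • c0Single s 1 := by rw [← map_smul, smul_eq_mul, mul_one]
    rw [h, φ.map_smul, smul_eq_mul, mul_comm]
  have hmem : Memℓp u 1 := by
    refine memℓp_gen' (C := ‖φ‖) fun F => ?_
    simp only [ENNReal.toReal_one, Real.rpow_one]
    -- The conjugate phase of `u s`: testing `φ` on these coefficients over `F` returns `∑ ‖u s‖`,
    -- which is therefore at most `‖φ‖`.
    let c (s : S) : ℂ := if u s = 0 then 0 else (starRingEnd ℂ (u s)) / ‖u s‖
    have hc (s : S) : u s * c s = ‖u s‖ := by
      by_cases h : u s = 0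
      · simp [c, h]
      · have h2 : (‖u s‖ : ℂ) ≠ 0 := by simpa using h
        simp only [c, if_neg h]
        rw [mul_div_assoc', Complex.mul_conj', sq, mul_div_cancel_right₀ _ h2]
    have hc1 (s : S) : ‖c s‖ ≤ 1 := by
      by_cases h : u s = 0
      · simp [c, h]
      · simp [c, h]
    have hφ : φ (∑ s ∈ F, c0Single s (c s)) = ((∑ s ∈ F, ‖u s‖ : ℝ) : ℂ) := by
      rw [← ContinuousLinearMap.coe_coe, map_sum, Complex.ofReal_sum]
      exact Finset.sum_congr rfl fun s _ => (hu s _).trans (hc s)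
    have h := φ.le_of_opNorm_le_of_le le_rfl (norm_sum_c0Single_le F hc1)
    rw [hφ, Complex.norm_real, mul_one] at h
    exact (le_abs_self _).trans h
  refine ⟨⟨u, hmem⟩, fun f => ?_⟩
  have hsum : HasSum (fun s => c0Single s (f.1 s)) f := by
    have h := hasSum_single_of_mem_c0 f.2
    rw [HasSum] at *
    rw [tendsto_subtype_rng]
    simpa using h
  have h2 := φ.hasSum hsum
  simp only [hu] at h2
  exact h2.tsum_eq.symm

theorem pairing_eq_zero_of_forall_mem_c0 {a : Ell1 S} (h : ∀ f ∈ c0 S, pairing a f = 0) :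
    a = 0 := by
  classical
  ext s
  have := h _ (single_mem_c0 s 1)
  rw [pairing, tsum_eq_single s] at this
  · simpa using this
  · intro t ht
    simp [Pi.single_eq_of_ne ht]

/-- The canonical map `ℓ¹(S) → E*`. -/
noncomputable def toDual (E : Submodule ℂ (EllInf S)) : Ell1 S →L[ℂ] StrongDual ℂ E :=
  (ContinuousLinearMap.precomp ℂ E.subtypeL).comp (pairingCLM S)

@[simp]
theorem toDual_apply (E : Submodule ℂ (EllInf S)) (a : Ell1 S) (f : E) :
    toDual E a f = pairing a f := rfl

theorem toDual_c0_ker : (toDual (c0 S)).ker = ⊥ :=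
  LinearMap.ker_eq_bot'.mpr fun _ ha =>
    pairing_eq_zero_of_forall_mem_c0 fun f hf => DFunLike.congr_fun ha (⟨f, hf⟩ : c0 S)

theorem toDual_c0_range : (toDual (c0 S)).range = ⊤ :=
  LinearMap.range_eq_top.mpr fun φ => by
    obtain ⟨a, ha⟩ := exists_pairing_eq φ
    exact ⟨a, ContinuousLinearMap.ext fun f => (ha f).symm⟩

/-- The canonical map identifies `ℓ¹(S)` with the dual of `c₀(S)`. -/
noncomputable def dualEquivC0 (S : Type*) : Ell1 S ≃L[ℂ] StrongDual ℂ (c0 S) := by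
  refine ContinuousLinearEquiv.ofBijective (𝕜 := ℂ) (𝕜' := ℂ) (σ := RingHom.id ℂ) (E := Ell1 S)
    (F := StrongDual ℂ (c0 S)) (toDual (c0 S)) ?_ ?_
  · exact toDual_c0_ker
  · exact toDual_c0_range

theorem dualEquivC0_apply (a : Ell1 S) (f : c0 S) : dualEquivC0 S a f = pairing a f := rfl

/-- For `m : S → S → S` with `m s` finite-to-one, `t ↦ ∑ₛ a(s) f(m s t)` vanishes at infinity
as soon as `f` does. -/
theorem exists_mem_c0_apply_eq_tsum {m : S → S → S} (hm : ∀ s, Tendsto (m s) cofinite cofinite)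
    {f : EllInf S} (hf : f ∈ c0 S) (a : Ell1 S) :
    ∃ g ∈ c0 S, ∀ t, g t = ∑' s, a s * f (m s t) := by
  have hbound (s t : S) : ‖a s * f (m s t)‖ ≤ ‖a s‖ * ‖f‖ := by
    rw [norm_mul]
    exact mul_le_mul_of_nonneg_left (norm_apply_le f _) (norm_nonneg _)
  have hsum := (summable_norm_apply a).mul_right ‖f‖
  have hmem : Memℓp (fun t => ∑' s, a s * f (m s t)) ∞ := by
    refine memℓp_infty ⟨∑' s, ‖a s‖ * ‖f‖, ?_⟩
    rintro _ ⟨t, rfl⟩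
    exact tsum_of_norm_bounded hsum.hasSum fun s => hbound s t
  refine ⟨⟨_, hmem⟩, ?_, fun t => rfl⟩
  rw [mem_c0]
  -- Each term tends to zero as `m s` is finite-to-one, and `‖a s‖ * ‖f‖` dominates uniformly in
  -- `t`.
  have h := tendsto_tsum_of_dominated_convergence (𝓕 := cofinite)
    (f := fun t s => a s * f (m s t)) (g := fun _ => 0) hsum
    (fun s => by simpa using ((mem_c0.mp hf).comp (hm s)).const_mul (a s))
    (Eventually.of_forall fun t s => hbound s t)
  simpa using h

theorem isCStarPredual_c0 [Mul S] (hl : ∀ s : S, Tendsto (s * ·) cofinite cofinite)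
    (hr : ∀ s : S, Tendsto (· * s) cofinite cofinite) : IsCStarPredual (c0 S) where
  isClosed := isClosed_c0
  right_action f hf a := by
    obtain ⟨g, hg, hgf⟩ := exists_mem_c0_apply_eq_tsum (m := fun s t => s * t) hl hf a
    refine ⟨g, hg, fun b => ?_⟩
    -- The swap puts the variable of `b` in the outer sum.
    rw [pairing_conv, ← (Equiv.prodComm S S).tsum_eq]
    have h := (Equiv.prodComm S S).summable_iff.mpr (summable_conv_apply a b f)
    rw [Summable.tsum_prod (by exact h), pairing]
    refine tsum_congr fun t => ?_
    rw [hgf, ← tsum_mul_left]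
    refine tsum_congr fun s => ?_
    simp only [Equiv.prodComm_apply, Prod.swap_prod_mk]
    ring
  left_action f hf a := by
    obtain ⟨g, hg, hgf⟩ := exists_mem_c0_apply_eq_tsum (m := fun s t => t * s) hr hf a
    refine ⟨g, hg, fun b => ?_⟩
    rw [pairing_conv, (summable_conv_apply b a f).tsum_prod, pairing]
    refine tsum_congr fun t => ?_
    rw [hgf, ← tsum_mul_left]
    exact tsum_congr fun s => by ring
  dual_equiv := ⟨dualEquivC0 S, dualEquivC0_apply⟩
  mul_mem f hf g hg := mul_mem_c0 hf hg
  star_mem f hf := star_mem_c0 hf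

/-! ### General properties of preduals -/

/-- A closed subspace of `c₀(S)` whose annihilator in `ℓ¹(S)` is trivial is all of `c₀(S)`. -/
theorem eq_c0_of_le {E : Submodule ℂ (EllInf S)} (hE : IsClosed (E : Set (EllInf S)))
    (hle : E ≤ c0 S) (hann : ∀ a : Ell1 S, (∀ f ∈ E, pairing a f = 0) → a = 0) : E = c0 S := by
  refine le_antisymm hle fun f hf => ?_
  by_contra hfE
  have hne : E.mkQL f ≠ 0 := by
    rw [Submodule.mkQL_apply, Submodule.mkQ_apply, Ne, Submodule.Quotient.mk_eq_zero]
    exact hfE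
  -- Hahn–Banach in the quotient by `E`: `ψ` gives a functional that kills `E` but not `f`. On
  -- `c₀(S)` it is represented by some `a`, which the annihilator condition forces to vanish.
  obtain ⟨ψ, hψ⟩ := SeparatingDual.exists_ne_zero (R := ℂ) hne
  obtain ⟨a, ha⟩ := exists_pairing_eq (ψ ∘L E.mkQL ∘L (c0 S).subtypeL)
  have h0 : a = 0 := hann a fun g hg => by
    rw [← ha ⟨g, hle hg⟩]
    simp [(Submodule.Quotient.mk_eq_zero E).mpr hg]
  apply hψ
  have := ha ⟨f, hf⟩
  rw [h0] at this
  simpa [pairing] using this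

theorem IsPredual.eq_zero_of_forall_pairing_eq_zero [Mul S] {E : Submodule ℂ (EllInf S)}
    (hE : IsPredual E) {a : Ell1 S} (ha : ∀ f ∈ E, pairing a f = 0) : a = 0 := by
  obtain ⟨e, he⟩ := hE.dual_equiv
  refine e.injective ?_
  rw [map_zero]
  ext f
  rw [he, ha f f.2]
  rfl

/-- The action of a point mass is translation. This invariance later yields separate continuity of
the product. -/
theorem IsPredual.exists_forall_apply_mul_left [Mul S] {E : Submodule ℂ (EllInf S)}
    (hE : IsPredual E) (s : S) {f : EllInf S} (hf : f ∈ E) : ∃ g ∈ E, ∀ t, g t = f (s * t) := by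
  classical
  obtain ⟨g, hg, h⟩ := hE.right_action f hf (lp.single 1 s 1)
  exact ⟨g, hg, fun t => by simpa using h (lp.single 1 t 1)⟩

theorem IsPredual.exists_forall_apply_mul_right [Mul S] {E : Submodule ℂ (EllInf S)}
    (hE : IsPredual E) (s : S) {f : EllInf S} (hf : f ∈ E) : ∃ g ∈ E, ∀ t, g t = f (t * s) := by
  classical
  obtain ⟨g, hg, h⟩ := hE.left_action f hf (lp.single 1 s 1)
  exact ⟨g, hg, fun t => by simpa using h (lp.single 1 t 1)⟩

/-! ### Multiplicative functionals and the induced topology on `S` -/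

open scoped Classical in
/-- Evaluation at a point of `S`, as an element of the weak-star dual of `E`. -/
noncomputable def evalAt (E : Submodule ℂ (EllInf S)) (s : S) : WeakDual ℂ E :=
  StrongDual.toWeakDual (toDual E (lp.single 1 s 1))

@[simp]
theorem evalAt_apply (E : Submodule ℂ (EllInf S)) (s : S) (f : E) : evalAt E s f = f.1 s := by
  classical
  change pairing (lp.single 1 s 1) f.1 = _
  simp

/-- The multiplicative functionals on `E`, including zero. -/
def multiplicativeFunctionals (E : Submodule ℂ (EllInf S)) : Set (WeakDual ℂ E) :=
  {φ | ∀ f g h : E, (h : EllInf S) = f * g → φ h = φ f * φ g}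

theorem isClosed_multiplicativeFunctionals (E : Submodule ℂ (EllInf S)) :
    IsClosed (multiplicativeFunctionals E) := by
  simp only [multiplicativeFunctionals, Set.ofPred_forall]
  refine isClosed_iInter fun f => isClosed_iInter fun g => isClosed_iInter fun h =>
    isClosed_iInter fun _ => ?_
  exact isClosed_eq (WeakDual.eval_continuous h)
    ((WeakDual.eval_continuous f).mul (WeakDual.eval_continuous g))

theorem evalAt_mem_multiplicativeFunctionals (E : Submodule ℂ (EllInf S)) (s : S) :
    evalAt E s ∈ multiplicativeFunctionals E := by
  intro f g h hh
  simp [hh]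

/-- Distinct point masses are distinct in `ℓ¹(S)`, and `E` separates the elements of `ℓ¹(S)`. -/
theorem IsPredual.evalAt_injective [Mul S] {E : Submodule ℂ (EllInf S)} (hE : IsPredual E) :
    Function.Injective (evalAt E) := by
  classical
  intro s t h
  have h0 : (lp.single 1 s 1 - lp.single 1 t 1 : Ell1 S) = 0 :=
    hE.eq_zero_of_forall_pairing_eq_zero fun f hf => by
      have h1 := DFunLike.congr_fun h (⟨f, hf⟩ : E)
      simp only [evalAt_apply] at h1
      rw [← pairingCLM_apply, map_sub]
      simp [h1]
  by_contra hst
  have h1 := congrArg (fun a : Ell1 S => a s) h0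
  simp [Pi.single_eq_of_ne hst] at h1

theorem IsPredual.evalAt_ne_zero [Mul S] {E : Submodule ℂ (EllInf S)} (hE : IsPredual E) (s : S) :
    evalAt E s ≠ 0 := by
  classical
  intro h
  have h0 : (lp.single 1 s 1 : Ell1 S) = 0 :=
    hE.eq_zero_of_forall_pairing_eq_zero fun f hf => by
      have h1 := DFunLike.congr_fun h (⟨f, hf⟩ : E)
      rw [evalAt_apply] at h1
      rw [pairing_single, one_mul]
      exact h1
  have h1 := congrArg (fun a : Ell1 S => a s) h0
  simp at h1

/-- The only nonzero multiplicative functionals on a Hopf algebra predual are the evaluations. -/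
theorem IsHopfAlgebraPredual.mem_range_evalAt [Mul S] {E : Submodule ℂ (EllInf S)}
    (hE : IsHopfAlgebraPredual E) {φ : WeakDual ℂ E} (hφ : φ ∈ multiplicativeFunctionals E)
    (h0 : φ ≠ 0) : φ ∈ Set.range (evalAt E) := by
  obtain ⟨e, he⟩ := hE.dual_equiv
  obtain ⟨a, ha⟩ := e.surjective (WeakDual.toStrongDual φ)
  have hpair (f : E) : φ f = pairing a f := by
    rw [← he, ha]
    rfl
  -- Multiplicativity says that `a · (g - φ g)`, an element of `ℓ¹(S)`, annihilates `E`, so it is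
  -- zero. At any point `s` of the support of `a`, every `g` then satisfies `g s = φ g`.
  have hkey (g : E) (s : S) : a s * (g.1 s - φ g) = 0 := by
    have hmem : Memℓp (fun s => a s * (g.1 s - φ g)) 1 := by
      refine memℓp_gen ?_
      simp only [ENNReal.toReal_one, Real.rpow_one, norm_mul]
      refine Summable.of_nonneg_of_le (fun s => by positivity) (fun s => ?_)
        ((summable_norm_apply a).mul_right (‖g.1‖ + ‖φ g‖))
      exact mul_le_mul_of_nonneg_left
        ((norm_sub_le _ _).trans (add_le_add_left (norm_apply_le g.1 s) _)) (norm_nonneg _)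
    have hb : (⟨_, hmem⟩ : Ell1 S) = 0 := by
      refine hE.eq_zero_of_forall_pairing_eq_zero fun f hf => ?_
      have hfg := hφ ⟨f, hf⟩ g ⟨f * g.1, hE.mul_mem f hf g.1 g.2⟩ rfl
      rw [hpair, hpair ⟨f, hf⟩] at hfg
      have h1 := (summable_pairing a (f * g.1)).tsum_sub ((summable_pairing a f).mul_right (φ g))
      rw [tsum_mul_right] at h1
      change _ = pairing a (f * g.1) - pairing a f * φ g at h1
      rw [hfg, sub_self] at h1
      rw [← h1, pairing]
      refine tsum_congr fun s => ?_
      simp only [lp.infty_coeFn_mul, Pi.mul_apply]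
      ring
    exact congrArg (fun b : Ell1 S => b s) hb
  obtain ⟨s, hs⟩ : ∃ s, a s ≠ 0 := by
    by_contra! hall
    refine h0 (DFunLike.ext _ _ fun f => ?_)
    rw [hpair]
    change pairing a f = 0
    simp [pairing, hall]
  refine ⟨s, DFunLike.ext _ _ fun g => ?_⟩
  rw [evalAt_apply]
  exact sub_eq_zero.mp ((mul_eq_zero.mp (hkey g s)).resolve_left hs)

/-- Banach–Alaoglu: a multiplicative functional is zero or an evaluation, hence has norm at most
one. -/
theorem IsHopfAlgebraPredual.isCompact_multiplicativeFunctionals [Mul S]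
    {E : Submodule ℂ (EllInf S)} (hE : IsHopfAlgebraPredual E) :
    IsCompact (multiplicativeFunctionals E) := by
  refine (WeakDual.isCompact_closedBall (𝕜 := ℂ) (0 : StrongDual ℂ E) 1).of_isClosed_subset
    (isClosed_multiplicativeFunctionals E) fun φ hφ => ?_
  rw [Set.mem_preimage, Metric.mem_closedBall, dist_eq_norm (E := StrongDual ℂ E)]
  simp only [sub_zero]
  refine ContinuousLinearMap.opNorm_le_bound _ zero_le_one fun f => ?_
  rw [one_mul]
  by_cases h0 : φ = 0
  · subst h0
    simp
  · obtain ⟨s, rfl⟩ := hE.mem_range_evalAt hφ h0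
    change ‖evalAt E s f‖ ≤ ‖f‖
    rw [evalAt_apply]
    exact norm_apply_le f.1 s

/-- If every locally compact Hausdorff topology on `S` with separately continuous product is
discrete, then `c₀(S)` is the only possible Hopf algebra predual: the character space of such a
predual is a topology of this kind on `S`. -/
theorem IsHopfAlgebraPredual.eq_c0 [Mul S]
    (hS : ∀ (_ : TopologicalSpace S) [T2Space S] [LocallyCompactSpace S]
      [SeparatelyContinuousMul S], DiscreteTopology S)
    {E : Submodule ℂ (EllInf S)} (hE : IsHopfAlgebraPredual E) : E = c0 S := by
  let _ : TopologicalSpace S := TopologicalSpace.induced (evalAt E) inferInstance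
  have hind : IsInducing (evalAt E) := ⟨rfl⟩
  have hinj := hE.evalAt_injective
  have : T2Space S := T2Space.of_injective_continuous hinj hind.continuous
  have hcomp := hE.isCompact_multiplicativeFunctionals
  have hcontE (f : EllInf S) (hf : f ∈ E) : Continuous fun s => f s := by
    have h := (WeakDual.eval_continuous (⟨f, hf⟩ : E)).comp hind.continuous
    exact h.congr fun s => evalAt_apply E s _
  have : LocallyCompactSpace S := by
    have : CompactSpace (multiplicativeFunctionals E) := isCompact_iff_compactSpace.mp hcomp
    let ev (s : S) : multiplicativeFunctionals E :=
      ⟨evalAt E s, evalAt_mem_multiplicativeFunctionals E s⟩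
    have hev : IsInducing ev := IsInducing.of_comp
      (hind.continuous.subtype_mk _) continuous_subtype_val hind
    refine IsOpenEmbedding.locallyCompactSpace (f := ev)
      ⟨⟨hev, fun s t h => hinj (congrArg Subtype.val h)⟩, ?_⟩
    -- The image of `S` is the compact space of multiplicative functionals with zero removed, hence
    -- open in it.
    convert (isOpen_compl_singleton (x := (0 : WeakDual ℂ E))).preimage
      (continuous_subtype_val (p := (· ∈ multiplicativeFunctionals E))) using 1
    ext φ
    constructor
    · rintro ⟨s, rfl⟩
      exact hE.evalAt_ne_zero s
    · intro h
      obtain ⟨s, hs⟩ := hE.mem_range_evalAt φ.2 h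
      exact ⟨s, Subtype.ext hs⟩
  have : SeparatelyContinuousMul S := by
    refine ⟨fun {a} => ?_, fun {a} => ?_⟩
    -- Continuity is tested against each `f ∈ E`, whose translate by `a` is again in `E` and so
    -- continuous.
    · refine hind.continuous_iff.mpr (WeakDual.continuous_of_continuous_eval fun f => ?_)
      obtain ⟨g, hg, hgf⟩ := hE.exists_forall_apply_mul_left a f.2
      exact (hcontE g hg).congr fun t => by simp [hgf]
    · refine hind.continuous_iff.mpr (WeakDual.continuous_of_continuous_eval fun f => ?_)
      obtain ⟨g, hg, hgf⟩ := hE.exists_forall_apply_mul_right a f.2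
      exact (hcontE g hg).congr fun t => by simp [hgf]
  have : DiscreteTopology S := hS _
  refine eq_c0_of_le hE.isClosed (fun f hf => ?_)
    fun a => hE.eq_zero_of_forall_pairing_eq_zero
  rw [mem_c0, Metric.tendsto_nhds]
  intro ε hε
  rw [eventually_cofinite]
  simp only [dist_zero_right, not_lt]
  -- In the discrete topology finite means compact. The set where `ε ≤ ‖f s‖` corresponds to a
  -- closed subset of the compact set of multiplicative functionals; `0 < ε` keeps it away from
  -- zero, so it consists of evaluations.
  refine isCompact_iff_finite.mp (hind.isCompact_iff.mpr ?_)
  convert hcomp.inter_right (isClosed_le continuous_const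
    (WeakDual.eval_continuous (⟨f, hf⟩ : E)).norm : IsClosed {φ : WeakDual ℂ E |
      ε ≤ ‖φ (⟨f, hf⟩ : E)‖}) using 1
  ext φ
  constructor
  · rintro ⟨s, hs, rfl⟩
    refine ⟨evalAt_mem_multiplicativeFunctionals E s, ?_⟩
    rw [Set.mem_ofPred_eq, evalAt_apply]
    exact hs
  · rintro ⟨hφ, hφε⟩
    have h0 : φ ≠ 0 := by
      rintro rfl
      have h1 : ε ≤ ‖(0 : ℂ)‖ := hφε
      rw [norm_zero] at h1
      exact absurd h1 (not_le.mpr hε)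
    obtain ⟨s, rfl⟩ := hE.mem_range_evalAt hφ h0
    rw [Set.mem_ofPred_eq, evalAt_apply] at hφε
    exact ⟨s, hφε, rfl⟩

end SemigroupAlgebra

theorem mainTheorem9 {G I J : Type*} [Group G] [Countable G] [Finite I] [Finite J]
    (P : Matrix J I G) :
    (∀ E : Submodule ℂ (SemigroupAlgebra.EllInf (ReesMatrix P)),
      SemigroupAlgebra.IsCStarPredual E ↔ E = SemigroupAlgebra.c0 (ReesMatrix P)) ∧
    (∀ E : Submodule ℂ (SemigroupAlgebra.EllInf (ReesMatrix P)),
      SemigroupAlgebra.IsHopfAlgebraPredual E ↔ E = SemigroupAlgebra.c0 (ReesMatrix P)) ∧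
    (∀ (_ : TopologicalSpace (ReesMatrix P)) [T2Space (ReesMatrix P)]
      [LocallyCompactSpace (ReesMatrix P)] [SeparatelyContinuousMul (ReesMatrix P)],
      DiscreteTopology (ReesMatrix P)) := by
  have hdisc : ∀ (_ : TopologicalSpace (ReesMatrix P)) [T2Space (ReesMatrix P)]
      [LocallyCompactSpace (ReesMatrix P)] [SeparatelyContinuousMul (ReesMatrix P)],
      DiscreteTopology (ReesMatrix P) := fun _ _ _ _ => ReesMatrix.discreteTopology P
  have hc0 := SemigroupAlgebra.isCStarPredual_c0 (ReesMatrix.tendsto_const_mul_cofinite P)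
    (ReesMatrix.tendsto_mul_const_cofinite P)
  refine ⟨fun E => ⟨fun hE => hE.toIsHopfAlgebraPredual.eq_c0 hdisc, ?_⟩,
    fun E => ⟨fun hE => hE.eq_c0 hdisc, ?_⟩, hdisc⟩
  · rintro rfl
    exact hc0
  · rintro rfl
    exact hc0.toIsHopfAlgebraPredual
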